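/- Let $H$ be a finite-dimensional complex Hilbert space and $A=B(H)$. Morphisms below are linear maps, and $f^\dagger$ is the adjoint of $f$. **Classical structures.** A *classical structure* on a finite-dimensional Hilbert space $X$ is a linear map $\delta:X\to X\otimes X$ that is coassociative, cocommutative, satisfies $\delta^\dagger\circ\delta=\mathrm{id}$ and the H*-axiom: there is an involution $x\mapsto x^*$ on the set of linear maps $\mathbb C\to X$ with $\delta^\dagger\circ(x^*\otimes\mathrm{id})=(x^\dagger\otimes\mathrm{id})\circ\delta$ for all $x$ (identifying $\mathbb C\otimes X$ with $X$). The category $\mathbf{CS}[\mathbf{fdHilb}]$ has classical structures as objects; a morphism $(X,\delta_X)\to(Y,\delta_Y)$ is a linear map $f$ with $\delta_Y\circ f=(f\otimes f)\circ\delta_X$ and $\delta_Y^\dagger\circ(f\otimes f)=f\circ\delta_X^\dagger$. A *kernel* is a linear map $k$ with $k^\dagger\circ k=\mathrm{id}$; put $P(k)=k\circ k^\dagger$. A kernel $k:K\to X$ is *copyable* along $\delta$ if $\delta\circ P(k)=(P(k)\otimes P(k))\circ\delta$. Consider classical structures $\delta_i$ on spaces $K_i$ with given kernels $k_i:K_i\to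 H$. A kernel $m:L\to H$ is *copyable along* $(\delta_i,k_i)$ if $m=k_i\circ n$ for some $n:L\to K_i$ that is copyable along $\delta_i$; two such structures are *partially complementary* if no nontrivial kernel $m$ into $H$ (neither $0$ nor an isomorphism onto $H$) is copyable along both. **Algebras.** $\mathcal C(A)$ is the set of commutative von Neumann subalgebras of $A$, i.e. commutative $*$-subalgebras of $A$, not required to contain $\mathrm{id}_H$, that are closed in the weak operator topology. **Statement.** 1. The commutative C*-subalgebras of $A$ (norm closed commutative $*$-subalgebras, again not required to contain $\mathrm{id}_H$) are exactly the elements of $\mathcal C(A)$. An element $C$ of $\mathcal C(A)$ contains $\mathrm{id}_H$ if and only if it is a $*$-subalgebra containing $\mathrm{id}_H$ that equals its double commutant. 2. There is a bijection between $\mathcal C(A)$ and the collection of families $(\delta_i,k_i)_{i\in I}$ such that each $k_i:K_i\to H$ is a nonzero kernel whose domain carries the classical structure $\delta_i$; for $i\neq j$ the kernels $k_i$, $k_j$ represent different subobjects of $H$, and $(\delta_i,k_i)$, $(\delta_j,k_j)$ are partially complementary; and there is a classical structure $\delta$ on $H$ such that every $k_i$ is a morphism $\delta_i\to\delta$ in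 $\mathbf{CS}[\mathbf{fdHilb}]$. Here two families are identified if, up to a bijective reindexing, their kernels represent the same subobjects of $H$. The bijection sends the class of $(\delta_i,k_i)_{i\in I}$ to the $*$-algebra $C$ generated by the projections $P(k_i)$; these projections are exactly the minimal nonzero projections of $C$; and $C$ contains $\mathrm{id}_H$ if and only if the images of the $k_i$ together span $H$. 3. Equivalently, $\mathcal C(A)$ is in bijection, in the same way, with the collection of cocones of pairwise partially complementary classical substructures on $H$, i.e. classical structures $\delta$ on $H$ together with morphisms $k_i:\delta_i\to\delta$ $(i\in I)$ in $\mathbf{CS}[\mathbf{fdHilb}]$ that are nonzero kernels, represent different subobjects of $H$, and are pairwise partially complementary; again cocones are identified if, up to a bijective reindexing, their legs represent the same subobjects of $H$. -/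

import Mathlib

open scoped TensorProduct
open LinearMap (adjoint)

universe u v

/-- An object of the category of finite-dimensional complex Hilbert spaces. The monoidal unit is
`ℂ`, the tensor product is Mathlib's Hilbert space tensor product, morphisms are linear maps
(automatically bounded), and the dagger is the adjoint. -/
structure FdHilb : Type (u + 1) where
  carrier : Type u
  [normedAddCommGroup : NormedAddCommGroup carrier]
  [innerProductSpace : InnerProductSpace ℂ carrier]
  [finiteDimensional : FiniteDimensional ℂ carrier]

namespace FdHilb

instance : CoeSort FdHilb.{u} (Type u) := ⟨FdHilb.carrier⟩

attribute [instance] FdHilb.normedAddCommGroup FdHilb.innerProductSpace FdHilb.finiteDimensional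

end FdHilb

section Basic

variable {X : Type*} [NormedAddCommGroup X] [InnerProductSpace ℂ X] [FiniteDimensional ℂ X]
variable {Y : Type*} [NormedAddCommGroup Y] [InnerProductSpace ℂ Y] [FiniteDimensional ℂ Y]

/-- `f† ∘ f = id`. Among finite-dimensional Hilbert spaces these are exactly the dagger kernels:
such an `f` is the kernel of `id - f ∘ f†`. -/
def IsDaggerMonic (f : X →ₗ[ℂ] Y) : Prop :=
  adjoint f ∘ₗ f = LinearMap.id

/-- `P(k) = k ∘ k†`. -/
noncomputable def kernelProj (k : X →ₗ[ℂ] Y) : Y →ₗ[ℂ] Y :=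
  k ∘ₗ adjoint k

end Basic

/-- A classical structure on a finite-dimensional Hilbert space `X`: a cocommutative,
coassociative `δ : X → X ⊗ X` with `δ† ∘ δ = id` that satisfies the H*-axiom. -/
structure ClassicalStructure (X : Type*) [NormedAddCommGroup X] [InnerProductSpace ℂ X]
    [FiniteDimensional ℂ X] where
  δ : X →ₗ[ℂ] X ⊗[ℂ] X
  coassoc : (TensorProduct.assoc ℂ X X X).toLinearMap ∘ₗ TensorProduct.map δ LinearMap.id ∘ₗ δ =
    TensorProduct.map LinearMap.id δ ∘ₗ δ
  cocomm : (TensorProduct.comm ℂ X X).toLinearMap ∘ₗ δ = δ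
  daggerMonic : IsDaggerMonic δ
  /-- There is an involution `*` on the points `ℂ → X` such that
  `δ† ∘ (x* ⊗ id) = (x† ⊗ id) ∘ δ` up to the unit isomorphism `ℂ ⊗ X ≅ X`. -/
  hstar : ∃ s : (ℂ →ₗ[ℂ] X) → (ℂ →ₗ[ℂ] X), Function.Involutive s ∧ ∀ x : ℂ →ₗ[ℂ] X,
    adjoint δ ∘ₗ TensorProduct.map (s x) LinearMap.id ∘ₗ (TensorProduct.lid ℂ X).symm.toLinearMap =
      (TensorProduct.lid ℂ X).toLinearMap ∘ₗ TensorProduct.map (adjoint x) LinearMap.id ∘ₗ δ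

namespace ClassicalStructure

variable {X : Type*} [NormedAddCommGroup X] [InnerProductSpace ℂ X] [FiniteDimensional ℂ X]
variable {K : Type*} [NormedAddCommGroup K] [InnerProductSpace ℂ K] [FiniteDimensional ℂ K]

/-- An endomorphism `p` is copyable along `δ` when `δ ∘ p = (p ⊗ p) ∘ δ`. -/
def CopyableEndo (d : ClassicalStructure X) (p : X →ₗ[ℂ] X) : Prop :=
  d.δ ∘ₗ p = TensorProduct.map p p ∘ₗ d.δ

/-- A morphism `k : K → X` is copyable along `δ` when `P(k)` is. -/
def Copyable (d : ClassicalStructure X) (k : K →ₗ[ℂ] X) : Prop :=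
  d.CopyableEndo (kernelProj k)

end ClassicalStructure

/-- An object of the category `CS[fdHilb]` of classical structures. -/
structure CS : Type (u + 1) where
  space : FdHilb.{u}
  str : ClassicalStructure space

namespace CS

/-- The classical structure `d` on the Hilbert space `X`, as an object of `CS[fdHilb]`. -/
def of {X : Type u} [NormedAddCommGroup X] [InnerProductSpace ℂ X] [FiniteDimensional ℂ X]
    (d : ClassicalStructure X) : CS.{u} :=
  ⟨⟨X⟩, d⟩

/-- A morphism `(X, δ_X) → (Y, δ_Y)` is a morphism of Hilbert spaces that preserves both the
comultiplications `δ` and the multiplications `δ†`. -/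
@[ext]
structure Hom (A B : CS.{u}) : Type u where
  map : A.space →ₗ[ℂ] B.space
  map_comul : B.str.δ ∘ₗ map = TensorProduct.map map map ∘ₗ A.str.δ
  map_mul : adjoint B.str.δ ∘ₗ TensorProduct.map map map = map ∘ₗ adjoint A.str.δ

instance : CategoryTheory.Category CS.{u} where
  Hom := Hom
  id A :=
    { map := LinearMap.id
      map_comul := by rw [TensorProduct.map_id]; rfl
      map_mul := by rw [TensorProduct.map_id]; rfl }
  comp {A B C} f g :=
    { map := g.map ∘ₗ f.map
      map_comul := by
        rw [TensorProduct.map_comp, LinearMap.comp_assoc, ← f.map_comul, ← LinearMap.comp_assoc,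
          g.map_comul, LinearMap.comp_assoc]
      map_mul := by
        rw [TensorProduct.map_comp, ← LinearMap.comp_assoc, g.map_mul, LinearMap.comp_assoc,
          f.map_mul, LinearMap.comp_assoc] }

end CS

/-- A kernel `ι : K → H` whose domain carries a classical structure. (That `ι` is a morphism into a
classical structure on `H` is required of families and cocones of these, jointly.) -/
structure ClassicalSubstructure (H : Type u) [NormedAddCommGroup H] [InnerProductSpace ℂ H]
    [FiniteDimensional ℂ H] : Type (u + 1) where
  obj : CS.{u}
  ι : obj.space →ₗ[ℂ] H
  daggerMonic : IsDaggerMonic ι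

namespace ClassicalSubstructure

variable {H : Type u} [NormedAddCommGroup H] [InnerProductSpace ℂ H] [FiniteDimensional ℂ H]

/-- Along a classical structure on the domain of `ι : K → H`, a morphism `m : L → H` is copyable
when it factors through `ι` as a copyable morphism `L → K`. -/
def Copyable (S : ClassicalSubstructure H) {L : FdHilb.{u}} (m : L →ₗ[ℂ] H) : Prop :=
  ∃ n : L →ₗ[ℂ] S.obj.space, S.ι ∘ₗ n = m ∧ S.obj.str.Copyable n

/-- No nontrivial kernel `m : L → H` is copyable along both; the trivial kernels are the zero
kernel and the identity of `H` (up to isomorphism of subobjects). -/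
def PartiallyComplementary (S T : ClassicalSubstructure H) : Prop :=
  ∀ (L : FdHilb.{u}) (m : L →ₗ[ℂ] H), IsDaggerMonic m → S.Copyable m → T.Copyable m →
    m = 0 ∨ Function.Bijective m

/-- The underlying kernels represent the same subobject of `H`. -/
def SameSubobject (S T : ClassicalSubstructure H) : Prop :=
  ∃ e : S.obj.space ≃ₗ[ℂ] T.obj.space, T.ι ∘ₗ e.toLinearMap = S.ι

/-- The projection `P(ι)`, as an element of `B(H)`. -/
noncomputable def proj (S : ClassicalSubstructure H) : H →L[ℂ] H :=
  LinearMap.toContinuousLinearMap (kernelProj S.ι)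

theorem SameSubobject.refl (S : ClassicalSubstructure H) : S.SameSubobject S :=
  ⟨LinearEquiv.refl ℂ _, rfl⟩

theorem SameSubobject.symm {S T : ClassicalSubstructure H} (h : S.SameSubobject T) :
    T.SameSubobject S := by
  obtain ⟨e, he⟩ := h
  refine ⟨e.symm, ?_⟩
  rw [← he]
  ext x
  simp

theorem SameSubobject.trans {S T U : ClassicalSubstructure H} (h : S.SameSubobject T)
    (h' : T.SameSubobject U) : S.SameSubobject U := by
  obtain ⟨e, he⟩ := h
  obtain ⟨f, hf⟩ := h'
  refine ⟨e.trans f, ?_⟩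
  rw [← he, ← hf]
  rfl

end ClassicalSubstructure

/-- A family `(δ_i)` of classical structures on nonzero kernels of `H`, without repetition of
kernels, pairwise partially complementary, that all admit their inclusion as a morphism into some
common classical structure `δ` on `H`. -/
structure ComplementaryFamily (H : Type u) [NormedAddCommGroup H] [InnerProductSpace ℂ H]
    [FiniteDimensional ℂ H] : Type (max (u + 1) (v + 1)) where
  I : Type v
  S : I → ClassicalSubstructure H
  ne_zero : ∀ i, (S i).ι ≠ 0
  distinct : ∀ i j, i ≠ j → ¬ (S i).SameSubobject (S j)
  complementary : ∀ i j, i ≠ j → (S i).PartiallyComplementary (S j)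
  common : ∃ d : ClassicalStructure H, ∀ i, ∃ f : (S i).obj ⟶ CS.of d, CS.Hom.map f = (S i).ι

namespace ComplementaryFamily

variable {H : Type u} [NormedAddCommGroup H] [InnerProductSpace ℂ H] [FiniteDimensional ℂ H]

/-- The projections `P(k_i)` onto the members of the family. -/
def projections (F : ComplementaryFamily.{u, v} H) : Set (H →L[ℂ] H) :=
  Set.range fun i => (F.S i).proj

/-- Families are identified when, up to reindexing, they have the same underlying subobjects. -/
instance setoid (H : Type u) [NormedAddCommGroup H] [InnerProductSpace ℂ H]
    [FiniteDimensional ℂ H] : Setoid (ComplementaryFamily.{u, v} H) where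
  r F G := ∃ σ : F.I ≃ G.I, ∀ i, (F.S i).SameSubobject (G.S (σ i))
  iseqv :=
    { refl := fun F => ⟨Equiv.refl _, fun i => .refl (F.S i)⟩
      symm := by
        rintro F G ⟨σ, h⟩
        refine ⟨σ.symm, fun j => ?_⟩
        simpa using (h (σ.symm j)).symm
      trans := by
        rintro F G K ⟨σ, h⟩ ⟨τ, h'⟩
        exact ⟨σ.trans τ, fun i => (h i).trans (h' (σ i))⟩ }

end ComplementaryFamily

/-- A cocone of pairwise partially complementary classical substructures on `H`: a classical
structure `vertex` on `H` together with morphisms `leg i : obj i ⟶ vertex` of `CS[fdHilb]` that are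
nonzero kernels, represent distinct subobjects, and are pairwise partially complementary. -/
structure ComplementaryCocone (H : Type u) [NormedAddCommGroup H] [InnerProductSpace ℂ H]
    [FiniteDimensional ℂ H] : Type (max (u + 1) (v + 1)) where
  vertex : ClassicalStructure H
  I : Type v
  obj : I → CS.{u}
  leg : ∀ i, obj i ⟶ CS.of vertex
  daggerMonic : ∀ i, IsDaggerMonic (CS.Hom.map (leg i))
  ne_zero : ∀ i, CS.Hom.map (leg i) ≠ 0
  distinct : ∀ i j, i ≠ j → ¬ ClassicalSubstructure.SameSubobject (H := H)
    ⟨obj i, CS.Hom.map (leg i), daggerMonic i⟩ ⟨obj j, CS.Hom.map (leg j), daggerMonic j⟩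
  complementary : ∀ i j, i ≠ j → ClassicalSubstructure.PartiallyComplementary (H := H)
    ⟨obj i, CS.Hom.map (leg i), daggerMonic i⟩ ⟨obj j, CS.Hom.map (leg j), daggerMonic j⟩

namespace ComplementaryCocone

variable {H : Type u} [NormedAddCommGroup H] [InnerProductSpace ℂ H] [FiniteDimensional ℂ H]

/-- The family obtained by forgetting the vertex of a cocone. -/
def family (c : ComplementaryCocone.{u, v} H) : ComplementaryFamily.{u, v} H where
  I := c.I
  S i := ⟨c.obj i, CS.Hom.map (c.leg i), c.daggerMonic i⟩
  ne_zero := c.ne_zero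
  distinct := c.distinct
  complementary := c.complementary
  common := ⟨c.vertex, fun i => ⟨c.leg i, rfl⟩⟩

/-- Cocones are identified when, up to reindexing, their legs represent the same subobjects. -/
instance setoid (H : Type u) [NormedAddCommGroup H] [InnerProductSpace ℂ H]
    [FiniteDimensional ℂ H] : Setoid (ComplementaryCocone.{u, v} H) :=
  (ComplementaryFamily.setoid H).comap family

end ComplementaryCocone

section Algebras

variable {H : Type u} [NormedAddCommGroup H] [InnerProductSpace ℂ H] [CompleteSpace H]

/-- A commutative C*-subalgebra of `B(H)`: a norm closed commutative *-subalgebra, which need not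
contain the identity of `H`. -/
def IsCommCStarSubalgebra (C : NonUnitalStarSubalgebra ℂ (H →L[ℂ] H)) : Prop :=
  (∀ a ∈ C, ∀ b ∈ C, a * b = b * a) ∧ IsClosed (C : Set (H →L[ℂ] H))

/-- A commutative von Neumann subalgebra of `B(H)`: a commutative *-subalgebra that is closed in
the weak operator topology, and need not contain the identity of `H`. -/
def IsCommVonNeumannSubalgebra (C : NonUnitalStarSubalgebra ℂ (H →L[ℂ] H)) : Prop :=
  (∀ a ∈ C, ∀ b ∈ C, a * b = b * a) ∧
    IsClosed ((ContinuousLinearMapWOT.ofCLM : (H →L[ℂ] H) → (H →WOT[ℂ] H)) '' (C : Set (H →L[ℂ] H)))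

/-- The collection `𝒞(B(H))` of commutative von Neumann subalgebras of `B(H)`. -/
abbrev CommVonNeumannSubalgebra (H : Type u) [NormedAddCommGroup H] [InnerProductSpace ℂ H]
    [CompleteSpace H] : Type u :=
  {C : NonUnitalStarSubalgebra ℂ (H →L[ℂ] H) // IsCommVonNeumannSubalgebra C}

/-- The minimal nonzero projections of `C`, that is, the atoms of `Proj(C)`. -/
def minimalProjections (C : NonUnitalStarSubalgebra ℂ (H →L[ℂ] H)) : Set (H →L[ℂ] H) :=
  {p | p ∈ C ∧ IsStarProjection p ∧ p ≠ 0 ∧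
    ∀ q ∈ C, IsStarProjection q → q ≠ 0 → p * q = q → q = p}

end Algebras

/-! Both sides of the correspondence are encoded by the same data: sets of pairwise orthogonal
nonzero projections on `H`.

On the algebra side, finite dimension makes every *-subalgebra a closed subspace in both topologies.
A self-adjoint element is a combination of its spectral projections, so a commutative *-algebra is
spanned by its projections and hence by the minimal ones, which are orthogonal
(`le_span_minimalProjections`). Conversely, an orthogonal set of nonzero projections is exactly the
set of minimal projections of the algebra it generates (`minimalProjections_adjoin`).

On the categorical side, a classical structure is the same thing as an orthonormal basis, namely the
vectors it copies (`exists_copiesBasis`). Left multiplications for `δ†` form a commutative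
*-algebra, and its minimal projections correspond to the basis vectors. A morphism into `δ` that is
a kernel sends copied basis vectors to copied basis vectors, so each `k i` picks out a subset of one
common basis of `H`. Two such subsets cannot meet: a shared vector would span a line copyable along
both structures. Hence the projections of a family are orthogonal (`adjoint_ι_comp_ι`). In the other
direction, bases of the ranges of orthogonal projections extend to a basis of `H`, which supplies
the common structure (`exists_projections_eq`). -/

section ProjectionSets

/-! ### Orthogonal sets of projections and the algebras they generate -/

variable {H : Type u} [NormedAddCommGroup H] [InnerProductSpace ℂ H] [CompleteSpace H]

/-- A set of pairwise orthogonal nonzero projections. -/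
structure IsOrthogonalProjectionSet (P : Set (H →L[ℂ] H)) : Prop where
  isStarProjection : ∀ p ∈ P, IsStarProjection p
  ne_zero : ∀ p ∈ P, p ≠ 0
  mul_eq_zero : ∀ p ∈ P, ∀ q ∈ P, p ≠ q → p * q = 0

namespace IsOrthogonalProjectionSet

variable {P : Set (H →L[ℂ] H)} (hP : IsOrthogonalProjectionSet P)
include hP

/-- Multiplying a vanishing combination by `p` isolates the coefficient of `p`. In finite dimension
this makes `P` finite. -/
theorem linearIndepOn : LinearIndepOn ℂ id P := by
  rw [linearIndepOn_iff']
  intro t g ht h p hp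
  have h1 : p * ∑ q ∈ t, g q • id q = g p • p := by
    rw [Finset.mul_sum, Finset.sum_eq_single p]
    · simp [(hP.isStarProjection p (ht hp)).isIdempotentElem.eq]
    · intro q hq hqp
      simp [hP.mul_eq_zero p (ht hp) q (ht hq) hqp.symm]
    · exact fun h => absurd hp h
  rw [h, mul_zero] at h1
  exact (smul_eq_zero.1 h1.symm).resolve_right (hP.ne_zero p (ht hp))

/-- Each `p` cuts the span down to a line, so `p` behaves as an atom: the scalar is the coefficient
of `p` in `a`. -/
theorem mul_mem_span {p a : H →L[ℂ] H} (hp : p ∈ P) (ha : a ∈ Submodule.span ℂ P) :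
    ∃ c : ℂ, p * a = c • p ∧ a * p = c • p := by
  induction ha using Submodule.span_induction with
  | mem q hq =>
    by_cases h : p = q
    · subst h
      exact ⟨1, by simp [(hP.isStarProjection p hp).isIdempotentElem.eq]⟩
    · exact ⟨0, by simp [hP.mul_eq_zero p hp q hq h, hP.mul_eq_zero q hq p hp (Ne.symm h)]⟩
  | zero => exact ⟨0, by simp⟩
  | add x y _ _ hx hy =>
    obtain ⟨c, hc, hc'⟩ := hx
    obtain ⟨d, hd, hd'⟩ := hy
    exact ⟨c + d, by rw [mul_add, hc, hd, add_smul], by rw [add_mul, hc', hd', add_smul]⟩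
  | smul r x _ hx =>
    obtain ⟨c, hc, hc'⟩ := hx
    exact ⟨r * c, by rw [mul_smul_comm, hc, mul_smul], by rw [smul_mul_assoc, hc', mul_smul]⟩

/-- Products of members of `P` lie in `P ∪ {0}` and members are self-adjoint, so the span is already
closed under multiplication and star. -/
theorem mem_adjoin_iff {a : H →L[ℂ] H} :
    a ∈ NonUnitalStarAlgebra.adjoin ℂ P ↔ a ∈ Submodule.span ℂ P := by
  refine ⟨fun h => ?_, fun h => ?_⟩
  · induction h using NonUnitalStarAlgebra.adjoin_induction with
    | mem x hx => exact Submodule.subset_span hx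
    | add x y _ _ hx hy => exact add_mem hx hy
    | zero => exact zero_mem _
    | mul x y hx' _ hx hy =>
      clear hx'
      induction hx using Submodule.span_induction with
      | mem p hp =>
        obtain ⟨c, hc, -⟩ := hP.mul_mem_span hp hy
        rw [hc]
        exact Submodule.smul_mem _ _ (Submodule.subset_span hp)
      | zero => simp
      | add a b _ _ ha hb =>
        rw [add_mul]
        exact add_mem ha hb
      | smul r a _ ha =>
        rw [smul_mul_assoc]
        exact Submodule.smul_mem _ _ ha
    | smul r x _ hx => exact Submodule.smul_mem _ _ hx
    | star x hx' hx =>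
      clear hx'
      induction hx using Submodule.span_induction with
      | mem p hp =>
        rw [(hP.isStarProjection p hp).isSelfAdjoint.star_eq]
        exact Submodule.subset_span hp
      | zero => simp
      | add a b _ _ ha hb =>
        rw [star_add]
        exact add_mem ha hb
      | smul r a _ ha =>
        rw [star_smul]
        exact Submodule.smul_mem _ _ ha
  · induction h using Submodule.span_induction with
    | mem p hp => exact NonUnitalStarAlgebra.subset_adjoin ℂ P hp
    | zero => exact zero_mem _
    | add a b _ _ ha hb => exact add_mem ha hb
    | smul r a _ ha => exact SMulMemClass.smul_mem r ha

theorem adjoin_comm {a b : H →L[ℂ] H} (ha : a ∈ NonUnitalStarAlgebra.adjoin ℂ P)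
    (hb : b ∈ NonUnitalStarAlgebra.adjoin ℂ P) : a * b = b * a := by
  rw [hP.mem_adjoin_iff] at ha hb
  induction ha using Submodule.span_induction with
  | mem p hp =>
    obtain ⟨c, hc, hc'⟩ := hP.mul_mem_span hp hb
    rw [hc, hc']
  | zero => simp
  | add x y _ _ hx hy => rw [add_mul, mul_add, hx, hy]
  | smul r x _ hx => rw [smul_mul_assoc, mul_smul_comm, hx]

/-- A nonzero projection `p` of the span is not annihilated by all of `P`. If `q * p = c • q` with
`c ≠ 0`, idempotence of `p` forces `c = 1`, so `q` lies below `p`, and equals it when `p` is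
minimal. Conversely a nonzero projection of the span below `p ∈ P` is a scalar multiple of `p`,
hence `p`. -/
theorem minimalProjections_adjoin :
    minimalProjections (NonUnitalStarAlgebra.adjoin ℂ P) = P := by
  ext p
  constructor
  · rintro ⟨hp, hpp, hp0, hmin⟩
    rw [hP.mem_adjoin_iff] at hp
    have hex : ∃ q ∈ P, q * p ≠ 0 := by
      by_contra! h
      have : ∀ a ∈ Submodule.span ℂ P, a * p = 0 := fun a ha => by
        induction ha using Submodule.span_induction with
        | mem q hq => exact h q hq
        | zero => simp
        | add x y _ _ hx hy => rw [add_mul, hx, hy, add_zero]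
        | smul r x _ hx => rw [smul_mul_assoc, hx, smul_zero]
      exact hp0 (by rw [← hpp.isIdempotentElem.eq]; exact this p hp)
    obtain ⟨q, hq, hqp⟩ := hex
    obtain ⟨c, hc, hc'⟩ := hP.mul_mem_span hq hp
    have hq0 := hP.ne_zero q hq
    have hc0 : c ≠ 0 := by
      rintro rfl
      exact hqp (by rw [hc, zero_smul])
    have h2 : c • c • q = c • q := by
      rw [← hc', ← mul_smul_comm, ← hc', ← mul_assoc, hpp.isIdempotentElem.eq]
    have hpq : p * q = q := by
      rw [hc']
      exact smul_right_injective _ hc0 h2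
    rw [← hmin q (NonUnitalStarAlgebra.subset_adjoin ℂ P hq) (hP.isStarProjection q hq) hq0 hpq]
    exact hq
  · intro hp
    refine ⟨NonUnitalStarAlgebra.subset_adjoin ℂ P hp, hP.isStarProjection p hp, hP.ne_zero p hp,
      fun q hq hqq hq0 hpq => ?_⟩
    rw [hP.mem_adjoin_iff] at hq
    obtain ⟨c, hc, hc'⟩ := hP.mul_mem_span hp hq
    have hqc : q = c • p := by rw [← hpq, hc]
    have hc0 : c ≠ 0 := by
      rintro rfl
      exact hq0 (by rw [hqc, zero_smul])
    have h2 : c • q = c • p := by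
      calc c • q = q * p * q := by rw [hc', smul_mul_assoc, hpq]
        _ = c • p := by rw [mul_assoc, hpq, hqq.isIdempotentElem.eq, hqc]
    exact smul_right_injective _ hc0 h2

end IsOrthogonalProjectionSet

/-- The minimal projections of a commutative algebra are pairwise orthogonal. -/
theorem isOrthogonalProjectionSet_minimalProjections
    {C : NonUnitalStarSubalgebra ℂ (H →L[ℂ] H)} (hC : ∀ a ∈ C, ∀ b ∈ C, a * b = b * a) :
    IsOrthogonalProjectionSet (minimalProjections C) where
  isStarProjection p hp := hp.2.1
  ne_zero p hp := hp.2.2.1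
  mul_eq_zero p hp q hq hpq := by
    -- By commutativity `p * q` is a projection of `C` below both `p` and `q`; were it nonzero,
    -- minimality would make it equal to both.
    by_contra h
    have hm : p * q ∈ C := mul_mem hp.1 hq.1
    have hc : p * q = q * p := hC p hp.1 q hq.1
    have hs : IsStarProjection (p * q) := hp.2.1.mul hq.2.1 hc
    have h1 := hp.2.2.2 _ hm hs h (by rw [← mul_assoc, hp.2.1.isIdempotentElem.eq])
    have h2 := hq.2.2.2 _ hm hs h (by rw [hc, ← mul_assoc, hq.2.1.isIdempotentElem.eq])
    exact hpq (h1.symm.trans h2)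

end ProjectionSets

/-! ### Commutative *-algebras on a finite-dimensional space -/

section FiniteDimensional

variable {H : Type u} [NormedAddCommGroup H] [InnerProductSpace ℂ H] [FiniteDimensional ℂ H]
  [CompleteSpace H]

-- Finiteness lets the functional calculus be applied to arbitrary functions, in particular to
-- indicators of single eigenvalues.
omit [CompleteSpace H] in
theorem finite_spectrum_clm (a : H →L[ℂ] H) : (spectrum ℝ a).Finite := by
  have h : (spectrum ℂ a).Finite := by
    have := Module.End.finite_spectrum (Module.End.toContinuousLinearMap H |>.symm a)
    rwa [AlgEquiv.spectrum_eq] at this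
  exact (h.preimage (Complex.ofReal_injective.injOn)).subset fun r hr => by
    simpa using spectrum.algebraMap_mem ℂ hr

omit [CompleteSpace H] in
theorem finite_quasispectrum_clm (a : H →L[ℂ] H) : (quasispectrum ℝ a).Finite := by
  rw [quasispectrum_eq_spectrum_union_zero]
  exact (finite_spectrum_clm a).union (Set.finite_singleton 0)

variable (C : NonUnitalStarSubalgebra ℂ (H →L[ℂ] H))

theorem NonUnitalStarSubalgebra.isClosed_of_finiteDimensional :
    IsClosed (C : Set (H →L[ℂ] H)) :=
  C.toNonUnitalSubalgebra.toSubmodule.closed_of_finiteDimensional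

/-- The weak operator topology is a Hausdorff vector space topology, and finite-dimensional
subspaces are closed in any such topology. -/
theorem NonUnitalStarSubalgebra.isClosed_image_ofCLM :
    IsClosed ((ContinuousLinearMapWOT.ofCLM : (H →L[ℂ] H) → (H →WOT[ℂ] H)) ''
      (C : Set (H →L[ℂ] H))) := by
  let S := C.toNonUnitalSubalgebra.toSubmodule.map
    (ContinuousLinearMapWOT.linearEquiv ℂ (σ := RingHom.id ℂ) (E := H) (F := H)).symm.toLinearMap
  have : FiniteDimensional ℂ S := inferInstance
  exact S.closed_of_finiteDimensional

/-- A self-adjoint element is a combination of its spectral projections. -/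
theorem IsSelfAdjoint.mem_span_projections {a : H →L[ℂ] H} (ha : IsSelfAdjoint a) (haC : a ∈ C) :
    a ∈ Submodule.span ℂ {p | p ∈ C ∧ IsStarProjection p} := by
  have hfin := finite_quasispectrum_clm a
  have hcont (f : ℝ → ℝ) : ContinuousOn f (quasispectrum ℝ a) := hfin.continuousOn f
  -- The non-unital calculus requires functions vanishing at `0`. Dropping `0` costs nothing, since
  -- that eigenvalue contributes nothing to `a`; `cfcₙ (f r) a` is the spectral projection for `r`.
  set s := hfin.toFinset.erase 0
  let f : ℝ → ℝ → ℝ := fun r x => if x = r then 1 else 0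
  have hf0 : ∀ r ∈ s, f r 0 = 0 := fun r hr => if_neg (Finset.ne_of_mem_erase hr).symm
  have hsum : a = ∑ r ∈ s, (r : ℂ) • cfcₙ (f r) a := by
    have h1 : cfcₙ (∑ r ∈ s, fun x => r * f r x) a = ∑ r ∈ s, cfcₙ (fun x => r * f r x) a :=
      cfcₙ_sum (fun r x => r * f r x) a s (fun _ _ => hcont _) (fun r hr => by simp [hf0 r hr])
    have h2 : cfcₙ (∑ r ∈ s, fun x => r * f r x) a = a := by
      rw [cfcₙ_congr (g := id), cfcₙ_id ℝ a]
      intro x hx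
      rw [Finset.sum_apply]
      by_cases h : x = 0
      · subst h
        exact Finset.sum_eq_zero fun r hr => by simp [hf0 r hr]
      · have hxs : x ∈ s := by simp [s, h, hx]
        simp [f, hxs]
    nth_rw 1 [← h2]
    rw [h1]
    refine Finset.sum_congr rfl fun r hr => ?_
    rw [cfcₙ_const_mul r (f r) a (hcont _) (hf0 r hr)]
    simp
  rw [hsum]
  refine Submodule.sum_mem _ fun r hr => Submodule.smul_mem _ _ (Submodule.subset_span ⟨?_, ?_, ?_⟩)
  · have := C.isClosed_of_finiteDimensional
    exact cfcₙ_mem (f r) haC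
  · rw [IsIdempotentElem, ← cfcₙ_mul _ _ _ (hcont _) (hf0 r hr) (hcont _) (hf0 r hr)]
    congr 1
    ext x
    simp [f]
  · exact cfcₙ_predicate (f r) a

/-- The real and imaginary parts of an element of `C` lie in `C`, and each is a combination of
spectral projections. -/
theorem NonUnitalStarSubalgebra.le_span_projections :
    C.toNonUnitalSubalgebra.toSubmodule ≤ Submodule.span ℂ {p | p ∈ C ∧ IsStarProjection p} := by
  intro a (ha : a ∈ C)
  have hre : (realPart a : H →L[ℂ] H) ∈ C := by
    rw [realPart_apply_coe, ← Complex.coe_smul]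
    exact SMulMemClass.smul_mem _ (add_mem ha (star_mem ha))
  have him : (imaginaryPart a : H →L[ℂ] H) ∈ C := by
    rw [imaginaryPart_apply_coe, ← Complex.coe_smul]
    exact SMulMemClass.smul_mem _ (SMulMemClass.smul_mem _ (sub_mem ha (star_mem ha)))
  rw [← realPart_add_I_smul_imaginaryPart a]
  exact add_mem ((realPart a).2.mem_span_projections C hre)
    (Submodule.smul_mem _ _ ((imaginaryPart a).2.mem_span_projections C him))

variable {C} (hC : ∀ a ∈ C, ∀ b ∈ C, a * b = b * a)
include hC

/-- Below every nonzero projection of `C` there is a minimal one. -/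
theorem exists_minimalProjection_le {p : H →L[ℂ] H} (hp : p ∈ C) (hpp : IsStarProjection p)
    (hp0 : p ≠ 0) : ∃ q ∈ minimalProjections C, p * q = q := by
  -- The descending chain condition on subspaces provides a `q` whose range is minimal among the
  -- nonzero projections of `C` below `p`.
  let S : Set (Submodule ℂ H) :=
    {V | ∃ q ∈ C, IsStarProjection q ∧ q ≠ 0 ∧ p * q = q ∧ LinearMap.range q.toLinearMap = V}
  obtain ⟨V, ⟨q, hq, hqq, hq0, hpq, rfl⟩, hmin⟩ := (wellFounded_lt (α := Submodule ℂ H)).has_min S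
    ⟨_, p, hp, hpp, hp0, hpp.isIdempotentElem.eq, rfl⟩
  refine ⟨q, ⟨hq, hqq, hq0, fun r hr hrr hr0 hqr => ?_⟩, hpq⟩
  have hle : LinearMap.range r.toLinearMap ≤ LinearMap.range q.toLinearMap := by
    rintro _ ⟨x, rfl⟩
    exact ⟨r x, congrArg (fun f : H →L[ℂ] H => f x) hqr⟩
  have hge : LinearMap.range q.toLinearMap ≤ LinearMap.range r.toLinearMap := by
    by_contra h
    exact hmin _ ⟨r, hr, hrr, hr0, by rw [← hqr, ← mul_assoc, hpq], rfl⟩ (lt_of_le_not_ge hle h)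
  -- The ranges of `r` and `q` agree, so `r` fixes the range of `q`; commutativity replaces `q * r`
  -- by `r * q`.
  rw [← hqr, hC q hq r hr]
  ext x
  obtain ⟨y, hy : r y = q x⟩ := hge ⟨x, rfl⟩
  change r (q x) = q x
  rw [← hy]
  exact congrArg (fun f : H →L[ℂ] H => f y) hrr.isIdempotentElem.eq

/-- It suffices to treat a projection `p`. Let `s` be the sum of the minimal projections below `p`.
If `p - s` were nonzero, a minimal projection below it would lie below `p`, hence occur in `s`, and
so be annihilated by `p - s`. -/
theorem le_span_minimalProjections :
    C.toNonUnitalSubalgebra.toSubmodule ≤ Submodule.span ℂ (minimalProjections C) := by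
  have hM := isOrthogonalProjectionSet_minimalProjections hC
  have hfin : (minimalProjections C).Finite := hM.linearIndepOn.setFinite
  refine C.le_span_projections.trans (Submodule.span_le.2 ?_)
  rintro p ⟨hp, hpp⟩
  classical
  let t := hfin.toFinset.filter fun q => p * q = q
  have htm : ∀ q ∈ t, q ∈ minimalProjections C ∧ p * q = q := fun q hq => by simpa [t] using hq
  let s := ∑ q ∈ t, q
  have hsC : s ∈ C := sum_mem fun q hq => (htm q hq).1.1
  have hps : p * s = s := by
    rw [Finset.mul_sum]
    exact Finset.sum_congr rfl fun q hq => (htm q hq).2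
  have hsq : ∀ q ∈ t, s * q = q := fun q hq => by
    rw [Finset.sum_mul, Finset.sum_eq_single q]
    · exact (htm q hq).1.2.1.isIdempotentElem.eq
    · exact fun r hr hrq => hM.mul_eq_zero r (htm r hr).1 q (htm q hq).1 hrq
    · exact fun h => absurd hq h
  have hss : IsStarProjection s := by
    refine ⟨?_, ?_⟩
    · change s * s = s
      nth_rw 2 [show s = ∑ q ∈ t, q from rfl]
      rw [Finset.mul_sum]
      exact Finset.sum_congr rfl hsq
    · exact isSelfAdjoint_sum _ fun q hq => (htm q hq).1.2.1.isSelfAdjoint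
  have hsp : IsStarProjection (p - s) := hss.sub_of_mul_eq_right hpp hps
  have h0 : p - s = 0 := by
    by_contra h0
    obtain ⟨q, hq, hq'⟩ := exists_minimalProjection_le hC (sub_mem hp hsC) hsp h0
    have hpq : p * q = q := by
      nth_rw 1 [← hq']
      rw [← mul_assoc, mul_sub, hpp.isIdempotentElem.eq, hps, hq']
    have hqt : q ∈ t := by simpa [t] using ⟨hq, hpq⟩
    rw [sub_mul, hpq, hsq q hqt, sub_self] at hq'
    exact hq.2.2.1 hq'.symm
  rw [sub_eq_zero.1 h0]
  exact Submodule.sum_mem _ fun q hq => Submodule.subset_span (htm q hq).1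

theorem adjoin_minimalProjections :
    NonUnitalStarAlgebra.adjoin ℂ (minimalProjections C) = C := by
  have hM := isOrthogonalProjectionSet_minimalProjections hC
  refine le_antisymm (NonUnitalStarAlgebra.adjoin_le fun p hp => hp.1) fun a ha => ?_
  rw [hM.mem_adjoin_iff]
  exact le_span_minimalProjections hC ha

/-- A unital commutative *-algebra on a finite-dimensional space equals its double commutant. -/
theorem centralizer_centralizer_of_one_mem (h1 : (1 : H →L[ℂ] H) ∈ C) :
    Set.centralizer (Set.centralizer (C : Set (H →L[ℂ] H))) = C := by
  refine Set.Subset.antisymm (fun a ha => ?_) Set.subset_centralizer_centralizer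
  have hM := isOrthogonalProjectionSet_minimalProjections hC
  -- An `a` in the double commutant acts as a scalar on the range of each minimal projection, so `a
  -- * b ∈ C`; the case `b = 1` is the claim.
  have key : ∀ b ∈ Submodule.span ℂ (minimalProjections C), a * b ∈ C := fun b hb => by
    induction hb using Submodule.span_induction with
    | mem p hp =>
      -- Elements of `C` act as scalars on the range of `p`, so they commute with every rank one
      -- operator between vectors of that range.
      have hrank : ∀ x y : H, p x = x → p y = y →
          InnerProductSpace.rankOne ℂ y x ∈ Set.centralizer (C : Set (H →L[ℂ] H)) := by
        intro x y hx hy c hc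
        have hc' : c ∈ Submodule.span ℂ (minimalProjections C) := le_span_minimalProjections hC hc
        obtain ⟨k, hk, hk'⟩ := hM.mul_mem_span hp hc'
        have e1 : c y = k • y := by
          rw [← hy]
          exact congrArg (fun f : H →L[ℂ] H => f y) hk'
        ext z
        have e2 : inner ℂ x (c z) = k * inner ℂ x z := by
          have hsym : ∀ z, inner ℂ x z = inner ℂ x (p z) := fun z => by
            nth_rw 1 [← hx]
            rw [← ContinuousLinearMap.adjoint_inner_right, ← ContinuousLinearMap.star_eq_adjoint,
              hp.2.1.isSelfAdjoint.star_eq]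
          rw [hsym, hsym z, ← inner_smul_right]
          exact congrArg (fun f : H →L[ℂ] H => inner ℂ x (f z)) hk
        simp [e1, e2, smul_smul, mul_comm]
      obtain ⟨w, hw⟩ : ∃ w, p w ≠ 0 := by
        by_contra! h
        exact hp.2.2.1 (ContinuousLinearMap.ext h)
      set x := p w
      have hpp : ∀ z, p (p z) = p z := fun z =>
        congrArg (fun f : H →L[ℂ] H => f z) hp.2.1.isIdempotentElem.eq
      -- Evaluating at `x` the commutation of `a` with the rank one operator `v ↦ ⟨x, v⟩ p z` gives
      -- `⟨x, x⟩ a (p z) = ⟨x, a x⟩ p z`.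
      have hap : a * p = ((inner ℂ x x)⁻¹ * inner ℂ x (a x)) • p := by
        ext z
        have := congrArg (fun f : H →L[ℂ] H => f x) (ha _ (hrank x (p z) (hpp w) (hpp z)))
        simp only [mul_apply_eq_comp, InnerProductSpace.rankOne_apply, map_smul] at this
        rw [mul_apply_eq_comp, smul_apply, mul_smul, this,
          inv_smul_smul₀ (inner_self_ne_zero.2 hw)]
      rw [hap]
      exact SMulMemClass.smul_mem _ hp.1
    | zero => simp
    | add x y _ _ hx hy =>
      rw [mul_add]
      exact add_mem hx hy
    | smul r x _ hx =>
      rw [mul_smul_comm]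
      exact SMulMemClass.smul_mem _ hx
  simpa using key 1 (le_span_minimalProjections hC h1)

theorem one_mem_iff_exists_vonNeumannAlgebra :
    (1 : H →L[ℂ] H) ∈ C ↔ ∃ M : VonNeumannAlgebra H, (M : Set (H →L[ℂ] H)) = C := by
  refine ⟨fun h1 => ?_, ?_⟩
  · refine ⟨{ carrier := C
              mul_mem' := mul_mem
              add_mem' := add_mem
              algebraMap_mem' := fun r => ?_
              star_mem' := star_mem
              centralizer_centralizer' := centralizer_centralizer_of_one_mem hC h1 }, rfl⟩
    rw [Algebra.algebraMap_eq_smul_one]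
    exact SMulMemClass.smul_mem _ h1
  · rintro ⟨M, hM⟩
    rw [← SetLike.mem_coe, ← hM]
    exact one_mem M

end FiniteDimensional

/-! ### Comultiplications that copy an orthonormal basis -/

theorem TensorProduct.inner_map_right {E F E' F' : Type*}
    [NormedAddCommGroup E] [InnerProductSpace ℂ E] [FiniteDimensional ℂ E]
    [NormedAddCommGroup F] [InnerProductSpace ℂ F] [FiniteDimensional ℂ F]
    [NormedAddCommGroup E'] [InnerProductSpace ℂ E'] [FiniteDimensional ℂ E']
    [NormedAddCommGroup F'] [InnerProductSpace ℂ F'] [FiniteDimensional ℂ F']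
    (f : E →ₗ[ℂ] E') (g : F →ₗ[ℂ] F') (s : E' ⊗[ℂ] F') (t : E ⊗[ℂ] F) :
    inner ℂ s (TensorProduct.map f g t) =
      inner ℂ (TensorProduct.map (adjoint f) (adjoint g) s) t := by
  rw [← TensorProduct.adjoint_map]
  exact (LinearMap.adjoint_inner_left _ _ _).symm

section CopiedBases

variable {X : Type*} [NormedAddCommGroup X] [InnerProductSpace ℂ X] [FiniteDimensional ℂ X]
variable {ι : Type*} [Fintype ι]

/-- A map `δ : X → X ⊗ X` copies the orthonormal basis `b`. -/
def CopiesBasis (δ : X →ₗ[ℂ] X ⊗[ℂ] X) (b : OrthonormalBasis ι ℂ X) : Prop :=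
  ∀ i, δ (b i) = b i ⊗ₜ[ℂ] b i

namespace CopiesBasis

variable {δ : X →ₗ[ℂ] X ⊗[ℂ] X} {b : OrthonormalBasis ι ℂ X} (h : CopiesBasis δ b)
include h

theorem inner_adjoint_tmul (i : ι) (x y : X) :
    inner ℂ (b i) (adjoint δ (x ⊗ₜ[ℂ] y)) = inner ℂ (b i) x * inner ℂ (b i) y := by
  rw [LinearMap.adjoint_inner_right, h i, TensorProduct.inner_tmul]

/-- The product `δ†` is coordinatewise multiplication in the basis `b`. -/
theorem adjoint_tmul (i : ι) (x : X) :
    adjoint δ (x ⊗ₜ[ℂ] b i) = inner ℂ (b i) x • b i := by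
  classical
  refine InnerProductSpace.ext_inner_left_basis b.toBasis fun j => ?_
  rw [OrthonormalBasis.coe_toBasis, h.inner_adjoint_tmul, inner_smul_right]
  rcases eq_or_ne j i with rfl | hij
  · rfl
  · simp [b.inner_eq_ite, hij]

/-- Pairing `δ x = x ⊗ x` with `b i ⊗ b j` shows that the coordinates of `x` are idempotent and that
distinct ones multiply to zero. So exactly one is nonzero, and it is `1`. -/
theorem exists_eq_of_copyable {x : X} (hx : δ x = x ⊗ₜ[ℂ] x) (hx0 : x ≠ 0) : ∃ i, x = b i := by
  classical
  have hmul (i j : ι) : inner ℂ (b i) x * inner ℂ (b j) x =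
      if i = j then inner ℂ (b i) x else 0 := by
    rw [← TensorProduct.inner_tmul, ← hx, ← LinearMap.adjoint_inner_left, h.adjoint_tmul,
      inner_smul_left, b.inner_eq_ite]
    by_cases hij : i = j
    · simp [hij]
    · simp [hij, Ne.symm hij]
  obtain ⟨i, hi⟩ : ∃ i, inner ℂ (b i) x ≠ 0 := by
    by_contra! h0
    exact hx0 (InnerProductSpace.ext_inner_left_basis b.toBasis fun i => by simp [h0 i])
  have h1 : inner ℂ (b i) x = 1 := by
    have := hmul i i
    rw [if_pos rfl] at this
    exact mul_left_cancel₀ hi (by rw [this, mul_one])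
  refine ⟨i, InnerProductSpace.ext_inner_left_basis b.toBasis fun j => ?_⟩
  rw [OrthonormalBasis.coe_toBasis, b.inner_eq_ite]
  rcases eq_or_ne j i with rfl | hij
  · rw [if_pos rfl, h1]
  · rw [if_neg hij]
    simpa [h1, hij.symm] using hmul i j

theorem isDaggerMonic : IsDaggerMonic δ :=
  b.toBasis.ext fun i => by simp [h i, h.adjoint_tmul]

end CopiesBasis

/-- The classical structure that copies a given orthonormal basis. -/
noncomputable def OrthonormalBasis.classicalStructure (b : OrthonormalBasis ι ℂ X) :
    ClassicalStructure X :=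
  have h : CopiesBasis (b.toBasis.constr ℂ fun i => b i ⊗ₜ[ℂ] b i) b := fun i => by
    rw [← b.coe_toBasis, Module.Basis.constr_basis]
  { δ := b.toBasis.constr ℂ fun i => b i ⊗ₜ[ℂ] b i
    coassoc := b.toBasis.ext fun i => by simp [h i]
    cocomm := b.toBasis.ext fun i => by simp [h i]
    daggerMonic := h.isDaggerMonic
    hstar := by
      -- The involution conjugates the coordinates of a point in the basis `b`.
      refine ⟨fun x => LinearMap.toSpanSingleton ℂ X
          (b.repr.symm (WithLp.toLp 2 (star (b.repr (x 1)).ofLp))),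
        fun x => by ext; simp, fun x => b.toBasis.ext fun i => ?_⟩
      have hadj : adjoint x (b i) = inner ℂ (x 1) (b i) := by
        rw [← LinearMap.adjoint_inner_right]
        simp
      have hconj : inner ℂ (b i) (b.repr.symm (WithLp.toLp 2 (star (b.repr (x 1)).ofLp))) =
          inner ℂ (x 1) (b i) := by
        rw [← b.repr_apply_apply]
        simp [b.repr_apply_apply]
      simp [h i, h.adjoint_tmul, hadj, hconj] }

theorem OrthonormalBasis.copiesBasis_classicalStructure (b : OrthonormalBasis ι ℂ X) :
    CopiesBasis b.classicalStructure.δ b := fun i => by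
  change b.toBasis.constr ℂ (fun i => b i ⊗ₜ[ℂ] b i) (b i) = _
  rw [← b.coe_toBasis, Module.Basis.constr_basis]

end CopiedBases

/-! ### From a classical structure to the basis it copies -/

namespace ClassicalStructure

variable {X : Type*} [NormedAddCommGroup X] [InnerProductSpace ℂ X] [FiniteDimensional ℂ X]
variable (d : ClassicalStructure X)

/-- Left multiplication for the product `δ†`. -/
noncomputable def mulLeft : X →ₗ[ℂ] X →L[ℂ] X :=
  LinearMap.toContinuousLinearMap.toLinearMap ∘ₗ (TensorProduct.mk ℂ X X).compr₂ (adjoint d.δ)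

theorem mulLeft_apply (x y : X) : d.mulLeft x y = adjoint d.δ (x ⊗ₜ[ℂ] y) := rfl

/-- This is associativity of `δ†`, the adjoint of coassociativity: both sides are paired with `w`,
and the associator is an isometry. -/
theorem mulLeft_mulLeft (x y : X) : d.mulLeft (d.mulLeft x y) = d.mulLeft x * d.mulLeft y := by
  ext z
  refine ext_inner_right ℂ fun w => ?_
  have hl : inner ℂ (d.mulLeft (d.mulLeft x y) z) w =
      inner ℂ ((x ⊗ₜ[ℂ] y) ⊗ₜ[ℂ] z) (TensorProduct.map d.δ LinearMap.id (d.δ w)) := by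
    rw [TensorProduct.inner_map_right, TensorProduct.map_tmul, ← LinearMap.adjoint_inner_left d.δ]
    simp [mulLeft_apply]
  have hr : inner ℂ ((d.mulLeft x * d.mulLeft y) z) w =
      inner ℂ (x ⊗ₜ[ℂ] (y ⊗ₜ[ℂ] z)) (TensorProduct.map LinearMap.id d.δ (d.δ w)) := by
    rw [TensorProduct.inner_map_right, TensorProduct.map_tmul, ← LinearMap.adjoint_inner_left d.δ]
    simp [mulLeft_apply]
  have hw := LinearMap.congr_fun d.coassoc w
  simp only [LinearMap.comp_apply, LinearEquiv.coe_coe] at hw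
  rw [hl, hr, ← hw, ← TensorProduct.assocIsometry_apply,
    ← (TensorProduct.assocIsometry ℂ X X X).inner_map_map]
  rfl

theorem mulLeft_comm (x y : X) : d.mulLeft x y = d.mulLeft y x := by
  refine ext_inner_right ℂ fun w => ?_
  rw [mulLeft_apply, mulLeft_apply, LinearMap.adjoint_inner_left, LinearMap.adjoint_inner_left]
  have hw := LinearMap.congr_fun d.cocomm w
  simp only [LinearMap.comp_apply, LinearEquiv.coe_coe] at hw
  nth_rw 1 [← hw]
  rw [← TensorProduct.commIsometry_apply,
    ← (TensorProduct.commIsometry ℂ X X).inner_map_map (y ⊗ₜ[ℂ] x)]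
  rfl

/-- This is what the H*-axiom is for: the left multiplications are closed under adjoints. -/
theorem exists_mulLeft_adjoint (x : X) :
    ∃ x' : X, ∀ y z, inner ℂ (d.mulLeft x y) z = inner ℂ y (d.mulLeft x' z) := by
  obtain ⟨s, -, hs⟩ := d.hstar
  refine ⟨s (LinearMap.toSpanSingleton ℂ X x) 1, fun y z => ?_⟩
  have hz := LinearMap.congr_fun (hs (LinearMap.toSpanSingleton ℂ X x)) z
  simp only [LinearMap.comp_apply, LinearEquiv.coe_coe, TensorProduct.lid_symm_apply,
    TensorProduct.map_tmul, LinearMap.id_apply] at hz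
  rw [mulLeft_apply, mulLeft_apply, hz, LinearMap.adjoint_inner_left,
    ← TensorProduct.lidIsometry_apply,
    ← (TensorProduct.lidIsometry ℂ X).symm.inner_map_map y, LinearIsometryEquiv.symm_apply_apply,
    TensorProduct.lidIsometry_symm_apply,
    TensorProduct.inner_map_right, LinearMap.adjoint_adjoint]
  simp

/-- If `x` annihilates everything, then `⟨y z, x⟩ = ⟨z, y' x⟩ = 0`, so `x` is orthogonal to the
range of `δ†`. That range is everything because `δ† ∘ δ = id`. No unit is needed. -/
theorem mulLeft_injective : Function.Injective d.mulLeft := by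
  rw [← LinearMap.ker_eq_bot, LinearMap.ker_eq_bot']
  intro x hx
  have h0 : ∀ t : X ⊗[ℂ] X, inner ℂ (adjoint d.δ t) x = 0 := fun t => by
    induction t using TensorProduct.induction_on with
    | zero => simp
    | tmul y z =>
      obtain ⟨y', hy'⟩ := d.exists_mulLeft_adjoint y
      rw [← mulLeft_apply, hy', mulLeft_comm, hx]
      simp
    | add a b ha hb => rw [map_add, inner_add_left, ha, hb, add_zero]
  have h1 := h0 (d.δ x)
  rw [← LinearMap.comp_apply, d.daggerMonic] at h1
  exact inner_self_eq_zero.1 h1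

/-- The commutative *-algebra of left multiplications of a classical structure. -/
noncomputable def mulAlgebra [CompleteSpace X] : NonUnitalStarSubalgebra ℂ (X →L[ℂ] X) where
  carrier := Set.range d.mulLeft
  add_mem' := by
    rintro _ _ ⟨x, rfl⟩ ⟨y, rfl⟩
    exact ⟨x + y, map_add _ _ _⟩
  zero_mem' := ⟨0, map_zero _⟩
  mul_mem' := by
    rintro _ _ ⟨x, rfl⟩ ⟨y, rfl⟩
    exact ⟨d.mulLeft x y, d.mulLeft_mulLeft x y⟩
  smul_mem' := by
    rintro c _ ⟨x, rfl⟩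
    exact ⟨c • x, map_smul _ _ _⟩
  star_mem' := by
    rintro _ ⟨x, rfl⟩
    obtain ⟨x', hx'⟩ := d.exists_mulLeft_adjoint x
    refine ⟨x', ?_⟩
    rw [ContinuousLinearMap.star_eq_adjoint]
    ext z
    refine ext_inner_left ℂ fun y => ?_
    rw [← hx', ContinuousLinearMap.adjoint_inner_right]

theorem mulAlgebra_comm [CompleteSpace X] :
    ∀ a ∈ d.mulAlgebra, ∀ b ∈ d.mulAlgebra, a * b = b * a := by
  rintro _ ⟨x, rfl⟩ _ ⟨y, rfl⟩
  rw [← mulLeft_mulLeft, ← mulLeft_mulLeft, mulLeft_comm]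

/-- Every classical structure copies some orthonormal basis. -/
theorem exists_copiesBasis :
    ∃ b : OrthonormalBasis (Fin (Module.finrank ℂ X)) ℂ X, CopiesBasis d.δ b := by
  have : CompleteSpace X := FiniteDimensional.complete ℂ X
  have hcomm := d.mulAlgebra_comm
  have hM := isOrthogonalProjectionSet_minimalProjections hcomm
  have hspan := le_span_minimalProjections hcomm
  set M := minimalProjections d.mulAlgebra
  have hfin : M.Finite := hM.linearIndepOn.setFinite
  have : Fintype M := hfin.fintype
  have hex : ∀ p : M, ∃ x, d.mulLeft x = p := fun p => p.2.1
  choose e he using hex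
  have hsa : ∀ (p : M) x y, inner ℂ (p.1 x) y = inner ℂ x (p.1 y) := fun p x y => by
    rw [← ContinuousLinearMap.adjoint_inner_right, ← ContinuousLinearMap.star_eq_adjoint,
      (hM.isStarProjection p p.2).isSelfAdjoint.star_eq]
  have hee : ∀ p : M, p.1 (e p) = e p := fun p => d.mulLeft_injective <| by
    rw [← he p, mulLeft_mulLeft, he p, (hM.isStarProjection p p.2).isIdempotentElem.eq]
  have hne : ∀ p q : M, p ≠ q → p.1 (e q) = 0 := fun p q hpq => d.mulLeft_injective <| by
    rw [← he p, mulLeft_mulLeft, he p, he q, map_zero]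
    exact hM.mul_eq_zero p p.2 q q.2 fun h => hpq (Subtype.ext h)
  have he0 : ∀ p, e p ≠ 0 := fun p h => hM.ne_zero p p.2 (by rw [← he p, h, map_zero])
  have hcoef : ∀ (p : M) x, ∃ c : ℂ, p.1 x = c • e p := fun p x => by
    obtain ⟨c, hc, -⟩ := hM.mul_mem_span p.2 (hspan (show d.mulLeft x ∈ d.mulAlgebra from ⟨x, rfl⟩))
    refine ⟨c, d.mulLeft_injective ?_⟩
    rw [map_smul, he, ← hc, ← he p, mulLeft_mulLeft]
  -- Pairing with `x ⊗ y` gives a product of coordinates on both sides; the factor corrects for `e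
  -- p` not yet being known to have norm one.
  have hδ : ∀ p, d.δ (e p) = (inner ℂ (e p) (e p))⁻¹ • (e p ⊗ₜ[ℂ] e p) := fun p => by
    refine TensorProduct.ext_iff_inner_left.2 fun x y => ?_
    obtain ⟨a, ha⟩ := hcoef p x
    obtain ⟨b, hb⟩ := hcoef p y
    have hxy : p.1 (d.mulLeft x y) = (a * b) • e p := by
      calc p.1 (d.mulLeft x y) = (p.1 * d.mulLeft x) y := rfl
        _ = d.mulLeft (p.1 x) y := by rw [← he p, mulLeft_mulLeft]
        _ = (a * b) • e p := by rw [ha, map_smul, he, smul_apply, hb, smul_smul]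
    have hin : ∀ z (c : ℂ), p.1 z = c • e p →
        inner ℂ z (e p) = (starRingEnd ℂ) c * inner ℂ (e p) (e p) := fun z c hz => by
      rw [← inner_smul_left, ← hz, hsa, hee]
    rw [← LinearMap.adjoint_inner_left, ← mulLeft_apply, inner_smul_right,
      TensorProduct.inner_tmul, hin _ _ hxy, hin _ _ ha, hin _ _ hb, map_mul]
    have := inner_self_ne_zero (𝕜 := ℂ).2 (he0 p)
    field_simp
  -- Since `e p` is idempotent for `δ†`, the condition `δ† ∘ δ = id` forces the correcting factor to
  -- be `1`.
  have hnorm : ∀ p, inner ℂ (e p) (e p) = 1 := fun p => by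
    have h1 := LinearMap.congr_fun d.daggerMonic (e p)
    rw [LinearMap.comp_apply, hδ, map_smul, ← mulLeft_apply, he, hee, LinearMap.id_apply] at h1
    have h2 : ((inner ℂ (e p) (e p))⁻¹ - 1) • e p = 0 := by rw [sub_smul, h1, one_smul, sub_self]
    have h3 := (smul_eq_zero.1 h2).resolve_right (he0 p)
    exact inv_eq_one.1 (sub_eq_zero.1 h3)
  have hon : Orthonormal ℂ e := by
    classical
    rw [orthonormal_iff_ite]
    intro p q
    rcases eq_or_ne p q with rfl | hpq
    · rw [if_pos rfl, hnorm]
    · rw [if_neg hpq, ← hee q, ← hsa, hne q p hpq.symm, inner_zero_left]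
  have htop : ⊤ ≤ Submodule.span ℂ (Set.range e) := by
    intro x _
    have hx : d.mulLeft x ∈ Submodule.span ℂ M := hspan (show _ ∈ d.mulAlgebra from ⟨x, rfl⟩)
    have hMe : M = d.mulLeft '' Set.range e := by
      rw [← Set.range_comp, funext (f := d.mulLeft ∘ e) he, Subtype.range_coe]
    rw [hMe, Submodule.span_image] at hx
    obtain ⟨y, hy, hyx⟩ := hx
    rwa [← d.mulLeft_injective hyx]
  let b := OrthonormalBasis.mk hon htop
  refine ⟨b.reindex (Fintype.equivFinOfCardEq ?_), fun i => ?_⟩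
  · rw [Module.finrank_eq_card_basis b.toBasis]
  · rw [OrthonormalBasis.reindex_apply, OrthonormalBasis.coe_mk, hδ, hnorm, inv_one, one_smul]

end ClassicalStructure

/-! ### Classical substructures and their projections -/

namespace ClassicalSubstructure

variable {H : Type u} [NormedAddCommGroup H] [InnerProductSpace ℂ H] [FiniteDimensional ℂ H]
variable (S T : ClassicalSubstructure H)

theorem proj_apply (x : H) : S.proj x = S.ι (adjoint S.ι x) := rfl

theorem adjoint_ι_ι (x : S.obj.space) : adjoint S.ι (S.ι x) = x :=
  LinearMap.congr_fun S.daggerMonic x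

theorem inner_ι_ι (x y : S.obj.space) : inner ℂ (S.ι x) (S.ι y) = inner ℂ x y := by
  rw [← LinearMap.adjoint_inner_right, adjoint_ι_ι]

theorem ι_injective : Function.Injective S.ι :=
  Function.LeftInverse.injective S.adjoint_ι_ι

theorem proj_ι (x : S.obj.space) : S.proj (S.ι x) = S.ι x := by
  rw [proj_apply, adjoint_ι_ι]

theorem isStarProjection_proj [CompleteSpace H] : IsStarProjection S.proj where
  isIdempotentElem := ContinuousLinearMap.ext fun x => S.proj_ι _
  isSelfAdjoint := by
    rw [ContinuousLinearMap.isSelfAdjoint_iff_isSymmetric]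
    intro x y
    change inner ℂ (S.ι (adjoint S.ι x)) y = inner ℂ x (S.ι (adjoint S.ι y))
    rw [← LinearMap.adjoint_inner_right, LinearMap.adjoint_inner_left]

theorem proj_ne_zero (h : S.ι ≠ 0) : S.proj ≠ 0 := fun h0 =>
  h <| LinearMap.ext fun x => by rw [← proj_ι, h0]; simp

variable {S T}

theorem SameSubobject.proj_mul_proj (h : S.SameSubobject T) : T.proj * S.proj = S.proj := by
  obtain ⟨e, he⟩ := h
  ext x
  rw [mul_apply_eq_comp, proj_apply S, ← he]
  exact T.proj_ι _

/-- If the subobjects agree, each projection absorbs the other on the left; taking the adjoint of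
one relation identifies them. If the projections agree, `T.ι† ∘ S.ι` and `S.ι† ∘ T.ι` are mutually
inverse. -/
theorem sameSubobject_iff_proj_eq [CompleteSpace H] :
    S.SameSubobject T ↔ S.proj = T.proj := by
  refine ⟨fun h => ?_, fun h => ?_⟩
  · have h1 := congrArg star h.proj_mul_proj
    rw [star_mul, S.isStarProjection_proj.isSelfAdjoint.star_eq,
      T.isStarProjection_proj.isSelfAdjoint.star_eq, h.symm.proj_mul_proj] at h1
    exact h1.symm
  · have hST (x : S.obj.space) : T.ι (adjoint T.ι (S.ι x)) = S.ι x := by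
      rw [← proj_apply, ← h, proj_ι]
    have hTS (x : T.obj.space) : S.ι (adjoint S.ι (T.ι x)) = T.ι x := by
      rw [← proj_apply, h, proj_ι]
    refine ⟨LinearEquiv.ofLinearMap (adjoint T.ι ∘ₗ S.ι) (adjoint S.ι ∘ₗ T.ι)
      (LinearMap.ext fun x => ?_) (LinearMap.ext fun x => ?_), LinearMap.ext hST⟩
    · simp [hTS, adjoint_ι_ι]
    · simp [hST, adjoint_ι_ι]

theorem proj_eq_one_of_surjective (h : Function.Surjective S.ι) : S.proj = 1 := by
  ext x
  obtain ⟨y, rfl⟩ := h x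
  exact S.proj_ι y

variable {ι : Type*} [Fintype ι] {b : OrthonormalBasis ι ℂ S.obj.space}

/-- The line spanned by a copied basis vector is copyable. -/
theorem copyable_subtype_span (hb : CopiesBasis S.obj.str.δ b) (i : ι) {x : H}
    (hx : S.ι (b i) = x) :
    S.Copyable (L := ⟨Submodule.span ℂ {x}⟩) (Submodule.span ℂ {x}).subtype := by
  classical
  let V := Submodule.span ℂ {x}
  let v : V := ⟨x, Submodule.mem_span_singleton_self x⟩
  have hV (y : V) : ∃ c : ℂ, y = c • v := by
    obtain ⟨c, hc⟩ := Submodule.mem_span_singleton.1 y.2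
    exact ⟨c, Subtype.ext hc.symm⟩
  let n : V →ₗ[ℂ] S.obj.space := adjoint S.ι ∘ₗ V.subtype
  have hnv : n v = b i := by
    change adjoint S.ι x = b i
    rw [← hx, adjoint_ι_ι]
  have hvv : inner ℂ v v = (1 : ℂ) := by
    change inner ℂ x x = (1 : ℂ)
    rw [← hx, inner_ι_ι, b.inner_eq_one]
  -- `P(n)` is the projection onto `b i`, so it sends each copied basis vector to a copied vector or
  -- to zero.
  have hP (j : ι) : kernelProj n (b j) = if i = j then b i else 0 := by
    obtain ⟨c, hc⟩ := hV (adjoint n (b j))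
    have h1 : inner ℂ v (adjoint n (b j)) = if i = j then (1 : ℂ) else 0 := by
      rw [LinearMap.adjoint_inner_right, hnv, b.inner_eq_ite]
    rw [hc, inner_smul_right, hvv, mul_one] at h1
    change n (adjoint n (b j)) = _
    rw [hc, map_smul, hnv, h1, ite_smul, one_smul, zero_smul]
  refine ⟨n, LinearMap.ext fun y => ?_, b.toBasis.ext fun j => ?_⟩
  · obtain ⟨c, rfl⟩ := hV y
    change S.ι (n (c • v)) = c • x
    rw [map_smul, map_smul, hnv, hx]
  · change S.obj.str.δ (kernelProj n (b.toBasis j)) =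
      TensorProduct.map (kernelProj n) (kernelProj n) (S.obj.str.δ (b.toBasis j))
    rw [b.coe_toBasis, hb, TensorProduct.map_tmul, hP]
    split_ifs
    · exact hb i
    · simp

theorem _root_.isDaggerMonic_subtype (K : Submodule ℂ H) : IsDaggerMonic K.subtype :=
  LinearMap.ext fun x => ext_inner_left ℂ fun y => by
    rw [LinearMap.comp_apply, LinearMap.adjoint_inner_right]
    rfl

/-- The substructure on a subspace that copies a fixed orthonormal basis of it. -/
noncomputable def ofSubmodule (K : Submodule ℂ H) : ClassicalSubstructure H where
  obj := CS.of (stdOrthonormalBasis ℂ K).classicalStructure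
  ι := K.subtype
  daggerMonic := isDaggerMonic_subtype K

theorem proj_ofSubmodule_range [CompleteSpace H] {p : H →L[ℂ] H} (hp : IsStarProjection p) :
    (ofSubmodule (LinearMap.range p.toLinearMap)).proj = p := by
  ext x
  have h : adjoint (LinearMap.range p.toLinearMap).subtype x = ⟨p x, x, rfl⟩ := by
    refine ext_inner_left ℂ fun v => ?_
    rw [LinearMap.adjoint_inner_right]
    change inner ℂ (v : H) x = inner ℂ (v : H) (p x)
    obtain ⟨_, y, rfl⟩ := v
    change inner ℂ (p y) x = inner ℂ (p y) (p x)
    rw [← ContinuousLinearMap.adjoint_inner_left, ← ContinuousLinearMap.star_eq_adjoint,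
      hp.isSelfAdjoint.star_eq]
    exact congrArg (fun f : H →L[ℂ] H => inner ℂ (f y) x) hp.isIdempotentElem.eq.symm
  change (LinearMap.range p.toLinearMap).subtype
    (adjoint (LinearMap.range p.toLinearMap).subtype x) = p x
  rw [h]
  rfl

/-- When the basis of `K` is part of `b`, the inclusion takes copied vectors to copied vectors, and
both products are computed coordinatewise. -/
theorem ofSubmodule_hom (K : Submodule ℂ H) {κ : Type*} [Fintype κ] (b : OrthonormalBasis κ ℂ H)
    (hb : ∀ i, ∃ j, (stdOrthonormalBasis ℂ K i : H) = b j) :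
    ∃ f : (ofSubmodule K).obj ⟶ CS.of b.classicalStructure, CS.Hom.map f = (ofSubmodule K).ι := by
  have h := b.copiesBasis_classicalStructure
  have hK := (stdOrthonormalBasis ℂ K).copiesBasis_classicalStructure
  refine ⟨⟨K.subtype, (stdOrthonormalBasis ℂ K).toBasis.ext fun i => ?_,
    TensorProduct.ext (LinearMap.ext fun (x : K) =>
      (stdOrthonormalBasis ℂ K).toBasis.ext fun i => ?_)⟩,
    rfl⟩
  · obtain ⟨j, hj⟩ := hb i
    rw [OrthonormalBasis.coe_toBasis]
    change b.classicalStructure.δ (stdOrthonormalBasis ℂ K i : H) = TensorProduct.map K.subtype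
      K.subtype ((stdOrthonormalBasis ℂ K).classicalStructure.δ (stdOrthonormalBasis ℂ K i))
    rw [hK, TensorProduct.map_tmul, Submodule.subtype_apply, hj, h]
  · obtain ⟨j, hj⟩ := hb i
    rw [OrthonormalBasis.coe_toBasis]
    change adjoint b.classicalStructure.δ ((x : H) ⊗ₜ[ℂ] (stdOrthonormalBasis ℂ K i : H)) =
      K.subtype (adjoint (stdOrthonormalBasis ℂ K).classicalStructure.δ
        (x ⊗ₜ[ℂ] (stdOrthonormalBasis ℂ K i)))
    rw [hK.adjoint_tmul, map_smul, Submodule.subtype_apply, hj, h.adjoint_tmul, ← hj]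
    rfl

end ClassicalSubstructure

/-! ### Families and orthogonal sets of projections -/

namespace ComplementaryFamily

variable {H : Type u} [NormedAddCommGroup H] [InnerProductSpace ℂ H] [FiniteDimensional ℂ H]
  [CompleteSpace H]

section

variable (F : ComplementaryFamily.{u, v} H)

theorem proj_injective : Function.Injective fun i => (F.S i).proj := fun i j hij => by
  by_contra h
  exact F.distinct i j h (ClassicalSubstructure.sameSubobject_iff_proj_eq.2 hij)

/-- Both kernels carry their copied bases into the basis `b` of the common structure, and distinct
members of `b` are orthogonal. Only a shared member has to be excluded, which is where partial
complementarity enters. -/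
theorem adjoint_ι_comp_ι {i j : F.I} (hij : i ≠ j) : adjoint (F.S i).ι ∘ₗ (F.S j).ι = 0 := by
  obtain ⟨d, hd⟩ := F.common
  obtain ⟨b, hb⟩ := d.exists_copiesBasis
  -- A morphism preserves comultiplication, so the image of a copied vector is copied, and it is
  -- nonzero because the kernel is injective.
  have hmem (i : F.I) {ι : Type} [Fintype ι] {c : OrthonormalBasis ι ℂ (F.S i).obj.space}
      (hc : CopiesBasis (F.S i).obj.str.δ c) (s : ι) : ∃ t, (F.S i).ι (c s) = b t := by
    obtain ⟨f, hf⟩ := hd i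
    refine hb.exists_eq_of_copyable ?_ fun h0 => ?_
    · have h1 := LinearMap.congr_fun (CS.Hom.map_comul f) (c s)
      rw [hf] at h1
      change d.δ ((F.S i).ι (c s)) =
        TensorProduct.map (F.S i).ι (F.S i).ι ((F.S i).obj.str.δ (c s)) at h1
      rw [h1, hc, TensorProduct.map_tmul]
    · exact c.orthonormal.ne_zero s ((F.S i).ι_injective (by rw [h0, map_zero]))
  obtain ⟨ci, hci⟩ := (F.S i).obj.str.exists_copiesBasis
  obtain ⟨cj, hcj⟩ := (F.S j).obj.str.exists_copiesBasis
  refine cj.toBasis.ext fun r => InnerProductSpace.ext_inner_left_basis ci.toBasis fun s => ?_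
  rw [OrthonormalBasis.coe_toBasis, OrthonormalBasis.coe_toBasis, LinearMap.zero_apply,
    inner_zero_right, LinearMap.comp_apply, LinearMap.adjoint_inner_right]
  obtain ⟨t, ht⟩ := hmem i hci s
  obtain ⟨t', ht'⟩ := hmem j hcj r
  rw [ht, ht']
  refine b.inner_eq_zero fun htt => ?_
  subst htt
  rcases F.complementary i j hij ⟨Submodule.span ℂ {b t}⟩ (Submodule.span ℂ {b t}).subtype
    (isDaggerMonic_subtype _)
    (ClassicalSubstructure.copyable_subtype_span hci s ht)
    (ClassicalSubstructure.copyable_subtype_span hcj r ht') with h0 | hbij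
  · exact b.orthonormal.ne_zero t
      (LinearMap.congr_fun h0 ⟨b t, Submodule.mem_span_singleton_self _⟩)
  -- The line may be all of `H`, a trivial kernel that partial complementarity allows. Then both `k
  -- i` and `k j` are onto and represent the same subobject, against distinctness.
  · have hsurj (i : F.I) (x : (F.S i).obj.space) (hx : (F.S i).ι x = b t) :
        (F.S i).proj = 1 := by
      refine ClassicalSubstructure.proj_eq_one_of_surjective fun y => ?_
      obtain ⟨⟨y, hy⟩, rfl⟩ := hbij.2 y
      obtain ⟨c, rfl⟩ := Submodule.mem_span_singleton.1 hy
      exact ⟨c • x, by rw [map_smul, hx]; rfl⟩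
    exact hij (F.proj_injective ((hsurj i _ ht).trans (hsurj j _ ht').symm))

theorem isOrthogonalProjectionSet : IsOrthogonalProjectionSet F.projections where
  isStarProjection := by
    rintro _ ⟨i, rfl⟩
    exact (F.S i).isStarProjection_proj
  ne_zero := by
    rintro _ ⟨i, rfl⟩
    exact (F.S i).proj_ne_zero (F.ne_zero i)
  mul_eq_zero := by
    rintro _ ⟨i, rfl⟩ _ ⟨j, rfl⟩ hij
    ext x
    have h := LinearMap.congr_fun (F.adjoint_ι_comp_ι fun h : i = j => hij (by rw [h]))
      (adjoint (F.S j).ι x)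
    change (F.S i).ι (adjoint (F.S i).ι ((F.S j).ι (adjoint (F.S j).ι x))) = 0
    rw [LinearMap.comp_apply] at h
    rw [h, LinearMap.zero_apply, map_zero]

/-- Every element of the algebra has its range inside the span of the images. If that span is `H`,
the sum of the projections fixes each image and is therefore the identity. -/
theorem one_mem_adjoin_iff : (1 : H →L[ℂ] H) ∈ NonUnitalStarAlgebra.adjoin ℂ F.projections ↔
    ⨆ i, LinearMap.range (F.S i).ι = ⊤ := by
  have hP := F.isOrthogonalProjectionSet
  refine ⟨fun h => ?_, fun h => ?_⟩
  · rw [hP.mem_adjoin_iff] at h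
    have key : ∀ a ∈ Submodule.span ℂ F.projections, ∀ x,
        a x ∈ ⨆ i, LinearMap.range (F.S i).ι := fun a ha x => by
      induction ha using Submodule.span_induction with
      | mem p hp =>
        obtain ⟨i, rfl⟩ := hp
        exact Submodule.mem_iSup_of_mem i ⟨_, rfl⟩
      | zero => simp
      | add a b _ _ ha hb => exact add_mem ha hb
      | smul r a _ ha => exact Submodule.smul_mem _ _ ha
    exact eq_top_iff.2 fun x _ => key 1 h x
  · have hfin : F.projections.Finite := hP.linearIndepOn.setFinite
    let s := ∑ p ∈ hfin.toFinset, p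
    have hs : s = 1 := by
      have hle : ⨆ i, LinearMap.range (F.S i).ι ≤
          LinearMap.eqLocus s.toLinearMap (1 : H →L[ℂ] H).toLinearMap := by
        refine iSup_le fun i => ?_
        rintro _ ⟨x, rfl⟩
        have hi : (F.S i).proj ∈ F.projections := ⟨i, rfl⟩
        have hsi : s * (F.S i).proj = (F.S i).proj := by
          rw [Finset.sum_mul, Finset.sum_eq_single (F.S i).proj]
          · exact (F.S i).isStarProjection_proj.isIdempotentElem.eq
          · exact fun q hq hqi => hP.mul_eq_zero q (hfin.mem_toFinset.1 hq) _ hi hqi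
          · exact fun h0 => absurd (hfin.mem_toFinset.2 hi) h0
        change s ((F.S i).ι x) = (F.S i).ι x
        rw [← (F.S i).proj_ι x]
        exact congrArg (fun f : H →L[ℂ] H => f ((F.S i).ι x)) hsi
      ext x
      exact hle (h ▸ Submodule.mem_top : x ∈ ⨆ i, LinearMap.range (F.S i).ι)
    rw [← hs]
    exact sum_mem fun p hp => NonUnitalStarAlgebra.subset_adjoin ℂ _ (hfin.mem_toFinset.1 hp)

/-- The commutative von Neumann algebra generated by the projections of a family. -/
noncomputable def algebra : CommVonNeumannSubalgebra H :=
  ⟨NonUnitalStarAlgebra.adjoin ℂ F.projections,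
    fun _ ha _ hb => F.isOrthogonalProjectionSet.adjoin_comm ha hb,
    NonUnitalStarSubalgebra.isClosed_image_ofCLM _⟩

theorem minimalProjections_algebra : minimalProjections F.algebra.1 = F.projections :=
  F.isOrthogonalProjectionSet.minimalProjections_adjoin

end

/-- Distinct members have distinct projections, so the index type is recovered from the set of
projections up to a bijection. -/
theorem equiv_iff_projections_eq {F G : ComplementaryFamily.{u, v} H} :
    F ≈ G ↔ F.projections = G.projections := by
  refine ⟨?_, fun h => ?_⟩
  · rintro ⟨σ, h⟩
    have hσ : (fun i => (F.S i).proj) = (fun j => (G.S j).proj) ∘ σ :=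
      funext fun i => ClassicalSubstructure.sameSubobject_iff_proj_eq.1 (h i)
    rw [projections, projections, hσ, σ.surjective.range_comp]
  · let σ : F.I ≃ G.I := (Equiv.ofInjective _ F.proj_injective).trans
      ((Equiv.setCongr h).trans (Equiv.ofInjective _ G.proj_injective).symm)
    refine ⟨σ, fun i => ClassicalSubstructure.sameSubobject_iff_proj_eq.2 ?_⟩
    have : (Equiv.ofInjective _ G.proj_injective) (σ i) =
        Equiv.setCongr h (Equiv.ofInjective _ F.proj_injective i) :=
      Equiv.apply_symm_apply _ _
    exact (congrArg Subtype.val this).symm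

/-- The projections are recovered as the minimal projections of the algebra. -/
theorem equiv_iff_algebra_eq {F G : ComplementaryFamily.{u, v} H} :
    F ≈ G ↔ F.algebra = G.algebra := by
  rw [equiv_iff_projections_eq]
  refine ⟨fun h => Subtype.ext ?_, fun h => ?_⟩
  · simp only [algebra, h]
  · rw [← F.minimalProjections_algebra, h, G.minimalProjections_algebra]

-- Each range receives the classical structure of an orthonormal basis. These bases together are
-- orthonormal, and any extension to a basis of `H` gives the common structure. Orthogonal ranges
-- make partial complementarity immediate: a kernel copyable along both would land in two orthogonal
-- subspaces, so it is zero.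
open ClassicalSubstructure in
theorem exists_projections_eq {P : Set (H →L[ℂ] H)} (hP : IsOrthogonalProjectionSet P) :
    ∃ F : ComplementaryFamily.{u, v} H, F.projections = P := by
  have hfin : P.Finite := hP.linearIndepOn.setFinite
  have : Finite P := hfin
  let R (p : P) : Submodule ℂ H := LinearMap.range p.1.toLinearMap
  have hfix (p : P) {x : H} (hx : x ∈ R p) : p.1 x = x := by
    obtain ⟨y, rfl⟩ := hx
    exact congrArg (fun f : H →L[ℂ] H => f y) (hP.isStarProjection p p.2).isIdempotentElem.eq
  have hproj (p : P) : (ofSubmodule (R p)).proj = p.1 :=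
    proj_ofSubmodule_range (hP.isStarProjection p p.2)
  have horth {p q : P} (hpq : p ≠ q) {x y : H} (hx : x ∈ R p) (hy : y ∈ R q) :
      inner ℂ x y = 0 := by
    rw [← hfix p hx, ← hfix q hy, ← ContinuousLinearMap.adjoint_inner_right,
      ← ContinuousLinearMap.star_eq_adjoint,
      (hP.isStarProjection p p.2).isSelfAdjoint.star_eq, ← mul_apply_eq_comp,
      hP.mul_eq_zero p p.2 q q.2 fun h => hpq (Subtype.ext h)]
    simp
  let w : (Σ p : P, Fin (Module.finrank ℂ (R p))) → H := fun s =>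
    (stdOrthonormalBasis ℂ (R s.1) s.2 : H)
  have hw : Orthonormal ℂ w := by
    classical
    rw [orthonormal_iff_ite]
    rintro ⟨p, i⟩ ⟨q, j⟩
    by_cases hpq : p = q
    · subst hpq
      have := (stdOrthonormalBasis ℂ (R p)).inner_eq_ite i j
      simpa [w] using this
    · rw [if_neg fun h => hpq (congrArg Sigma.fst h)]
      exact horth hpq (Subtype.prop _) (Subtype.prop _)
  obtain ⟨t, b, ht, hb⟩ := hw.toSubtypeRange.exists_orthonormalBasis_extension
  -- The index type must live in the prescribed universe `v`, which is possible because `P` is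
  -- finite.
  let ψ := equivShrink.{v} P
  have hψ {i j : Shrink.{v} P} (hij : i ≠ j) : ψ.symm i ≠ ψ.symm j :=
    fun h => hij (ψ.symm.injective h)
  refine ⟨{ I := Shrink.{v} P
            S := fun i => ofSubmodule (R (ψ.symm i))
            ne_zero := fun i h0 => hP.ne_zero (ψ.symm i) (ψ.symm i).2 ?_
            distinct := fun i j hij h => hψ hij (Subtype.ext ?_)
            complementary := fun i j hij L m _ hi hj => Or.inl (LinearMap.ext fun x => ?_)
            common := ⟨b.classicalStructure, fun i => ofSubmodule_hom _ b fun k => ?_⟩ }, ?_⟩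
  · rw [← hproj]
    ext x
    rw [proj_apply, h0]
    rfl
  · rw [← hproj, ← hproj, sameSubobject_iff_proj_eq.1 h]
  · obtain ⟨n, hn, -⟩ := hi
    obtain ⟨n', hn', -⟩ := hj
    have hmi : m x ∈ R (ψ.symm i) := by
      rw [← hn]
      exact (n x).2
    have hmj : m x ∈ R (ψ.symm j) := by
      rw [← hn']
      exact (n' x).2
    exact inner_self_eq_zero.1 (horth (hψ hij) hmi hmj)
  · refine ⟨⟨w ⟨ψ.symm i, k⟩, ht ⟨_, rfl⟩⟩, ?_⟩
    rw [hb]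
  · change (Set.range fun i => (ofSubmodule (R (ψ.symm i))).proj) = P
    rw [funext fun i => hproj (ψ.symm i)]
    exact (ψ.symm.surjective.range_comp Subtype.val).trans Subtype.range_coe

theorem exists_algebra_eq (C : CommVonNeumannSubalgebra H) :
    ∃ F : ComplementaryFamily.{u, v} H, F.algebra = C := by
  obtain ⟨F, hF⟩ :=
    exists_projections_eq.{u, v} (isOrthogonalProjectionSet_minimalProjections C.2.1)
  refine ⟨F, Subtype.ext ?_⟩
  simp only [algebra, hF]
  exact adjoin_minimalProjections C.2.1

end ComplementaryFamily

/-! ### Cocones and the main theorem -/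

/-- A family only asserts that a common structure exists; choosing one, together with the morphisms
into it, gives a cocone. The choice is harmless, since the identification of cocones ignores the
vertex. -/
theorem ComplementaryCocone.exists_family_eq {H : Type u} [NormedAddCommGroup H]
    [InnerProductSpace ℂ H] [FiniteDimensional ℂ H] (F : ComplementaryFamily.{u, v} H) :
    ∃ c : ComplementaryCocone.{u, v} H, c.family = F := by
  obtain ⟨I, S, h0, hd, hc, d, hS⟩ := F
  have hS' := hS
  choose f hf using hS'
  have hS (i : I) : (⟨(S i).obj, CS.Hom.map (f i), by rw [hf]; exact (S i).daggerMonic⟩ :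
      ClassicalSubstructure H) = S i := by
    simp only [hf]
  refine ⟨⟨d, I, fun i => (S i).obj, f, fun i => by rw [hf]; exact (S i).daggerMonic,
    fun i => by rw [hf]; exact h0 i, fun i j hij => by rw [hS, hS]; exact hd i j hij,
    fun i j hij => by rw [hS, hS]; exact hc i j hij⟩, ?_⟩
  simp only [family, hS]

section

variable {H : Type u} [NormedAddCommGroup H] [InnerProductSpace ℂ H] [FiniteDimensional ℂ H]
  [CompleteSpace H]

theorem isCommCStarSubalgebra_iff (C : NonUnitalStarSubalgebra ℂ (H →L[ℂ] H)) :
    IsCommCStarSubalgebra C ↔ IsCommVonNeumannSubalgebra C :=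
  and_congr_right fun _ =>
    iff_of_true C.isClosed_of_finiteDimensional C.isClosed_image_ofCLM

/-- A map onto `𝒞(B(H))` whose fibres are the classes of a setoid induces a bijection. -/
theorem exists_equiv_quotient {α β : Type*} (s : Setoid α) (f : α → β)
    (hs : ∀ a b, a ≈ b ↔ f a = f b)
    (hf : Function.Surjective f) : ∃ e : β ≃ Quotient s, ∀ a, e.symm ⟦a⟧ = f a := by
  refine ⟨(Equiv.ofBijective (Quotient.lift f fun a b h => (hs a b).1 h) ⟨?_, fun y => ?_⟩).symm,
    fun a => rfl⟩
  · rintro ⟨a⟩ ⟨b⟩ h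
    exact Quotient.sound ((hs a b).2 h)
  · obtain ⟨a, rfl⟩ := hf y
    exact ⟨⟦a⟧, rfl⟩

end

theorem mainTheorem5 {H : Type u} [NormedAddCommGroup H] [InnerProductSpace ℂ H]
    [FiniteDimensional ℂ H] [CompleteSpace H] :
    -- commutative C*-subalgebras and commutative von Neumann subalgebras coincide, and the unital
    -- ones among them are the commutative algebras that equal their double commutant
    (∀ C : NonUnitalStarSubalgebra ℂ (H →L[ℂ] H),
      (IsCommCStarSubalgebra C ↔ IsCommVonNeumannSubalgebra C) ∧
      (IsCommVonNeumannSubalgebra C → ((1 : H →L[ℂ] H) ∈ C ↔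
        ∃ M : VonNeumannAlgebra H, (M : Set (H →L[ℂ] H)) = C))) ∧
    -- the correspondence with families of classical structures
    (∃ e : CommVonNeumannSubalgebra H ≃ Quotient (ComplementaryFamily.setoid.{u, v} H),
      ∀ F : ComplementaryFamily.{u, v} H,
        (e.symm ⟦F⟧).1 = NonUnitalStarAlgebra.adjoin ℂ F.projections ∧
        minimalProjections (e.symm ⟦F⟧).1 = F.projections ∧
        ((1 : H →L[ℂ] H) ∈ (e.symm ⟦F⟧).1 ↔ ⨆ i, LinearMap.range (F.S i).ι = ⊤)) ∧
    -- the correspondence with cocones of classical substructures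
    (∃ e : CommVonNeumannSubalgebra H ≃ Quotient (ComplementaryCocone.setoid.{u, v} H),
      ∀ c : ComplementaryCocone.{u, v} H,
        (e.symm ⟦c⟧).1 = NonUnitalStarAlgebra.adjoin ℂ c.family.projections ∧
        minimalProjections (e.symm ⟦c⟧).1 = c.family.projections ∧
        ((1 : H →L[ℂ] H) ∈ (e.symm ⟦c⟧).1 ↔
          ⨆ i, LinearMap.range (c.family.S i).ι = ⊤)) := by
  refine ⟨fun C => ⟨isCommCStarSubalgebra_iff C,
    fun hC => one_mem_iff_exists_vonNeumannAlgebra hC.1⟩, ?_, ?_⟩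
  · obtain ⟨e, he⟩ := exists_equiv_quotient (ComplementaryFamily.setoid.{u, v} H)
      (fun F => F.algebra) (fun _ _ => ComplementaryFamily.equiv_iff_algebra_eq)
      ComplementaryFamily.exists_algebra_eq
    refine ⟨e, fun F => ?_⟩
    rw [he]
    exact ⟨rfl, F.minimalProjections_algebra, F.one_mem_adjoin_iff⟩
  · obtain ⟨e, he⟩ := exists_equiv_quotient (ComplementaryCocone.setoid.{u, v} H)
      (fun c => c.family.algebra) (fun _ _ => ComplementaryFamily.equiv_iff_algebra_eq)
      fun C => by
        obtain ⟨F, rfl⟩ := ComplementaryFamily.exists_algebra_eq C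
        obtain ⟨c, rfl⟩ := ComplementaryCocone.exists_family_eq F
        exact ⟨c, rfl⟩
    refine ⟨e, fun c => ?_⟩
    rw [he]
    exact ⟨rfl, c.family.minimalProjections_algebra, c.family.one_mem_adjoin_iff⟩
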